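/- **Setting.** Let $V_{\mathcal P}$ and $V_{\mathcal H}$ be finite disjoint sets with $V_{\mathcal P}\neq\emptyset$, and let $G$ be a simple graph on $V_{\mathcal P}\cup V_{\mathcal H}$. A *configuration* in $\mathbb R^d$ is a pair $(p,\ell)$ of maps $p:V_{\mathcal P}\to\mathbb R^d$ and $\ell=(a,r):V_{\mathcal H}\to\mathbb R^d\times\mathbb R$; the vertex $j\in V_{\mathcal H}$ represents the hyperplane $\{x:\langle a_j,x\rangle-r_j=0\}$. Two vectors of $\mathbb R^d$ are *parallel* if one is a non-zero multiple of the other. $(G,p,\ell)$ is a *point-hyperplane framework*; its *parallel classes* are the classes of the equivalence relation "$a_j$ is parallel to $a_k$" on $V_{\mathcal H}$, and this partition is kept fixed as part of the data of $G$. The points and hyperplanes *span* $\mathbb R^d$ if the union of $p(V_{\mathcal P})$ and of all the hyperplanes affinely spans $\mathbb R^d$. Let $\mathbb W_G$ be the set of configurations $(q,(b,s))$ such that $b_j$ is parallel to $b_k$ for each edge $jk$ of $G$ joining two vertices of $V_{\mathcal H}$ in the same parallel class. The *measurement map* $f_G$ sends $(q,(b,s))\in\mathbb W_G$ to the tuple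 of the numbers $\|q_i-q_{i'}\|^2$ (edges $ii'$ of $G$ in $V_{\mathcal P}$), $\langle q_i,b_j\rangle-s_j$ (edges $ij$ with $i\in V_{\mathcal P}$, $j\in V_{\mathcal H}$), $\langle b_j,b_k\rangle$ (edges $jk$ in $V_{\mathcal H}$ between different parallel classes) and $\langle b_j,b_j\rangle$ ($j\in V_{\mathcal H}$). Let $K$ be the complete graph on $V_{\mathcal P}\cup V_{\mathcal H}$ with the same parallel classes, with $\mathbb W_K$ and $f_K:\mathbb W_K\to\mathbb R^N$ defined in the same way. Let $\mathscr A\subseteq\mathbb W_G$ be a smooth ($C^\infty$, embedded) submanifold of the space of configurations, and for $(q,m)\in\mathscr A$ let $d\tilde f_G(q,m)$, defined on the tangent space $T_{(q,m)}\mathscr A$, be the differential of $\tilde f_G=f_G|_{\mathscr A}$. A point $(p,\ell)\in\mathscr A$ is *$\mathscr A$-regular for $G$* if it has a neighbourhood $N$ in $\mathscr A$ such that $\operatorname{rank} d\tilde f_G(p,\ell)=\max\{\operatorname{rank} d\tilde f_G(q,m):(q,m)\in N\}$. An *$\mathscr A$-preserving infinitesimal flex* of $(G,p,\ell)$ is an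 element $(\dot p,(\dot a,\dot r))\in T_{(p,\ell)}\mathscr A$ of the kernel of $d\tilde f_G(p,\ell)$ that is not trivial, where *trivial* means that there are a skew-symmetric $d\times d$ matrix $S$ and $t\in\mathbb R^d$ with $\dot p_i=Sp_i+t$ for all $i\in V_{\mathcal P}$ and $\dot a_j=Sa_j$, $\dot r_j=\langle t,a_j\rangle$ for all $j\in V_{\mathcal H}$. An *$\mathscr A$-preserving finite flex* of $(G,p,\ell)$ is a differentiable path $x:[0,1]\to\mathscr A$ with $x(0)=(p,\ell)$ and $x(t)\in f_G^{-1}(f_G(p,\ell))\setminus f_K^{-1}(f_K(p,\ell))$ for all $t\in(0,1]$. **Theorem.** Let $(G,p,\ell)$ be a point-hyperplane framework whose points and hyperplanes span $\mathbb R^d$, let $\mathscr A$ be a smooth submanifold contained in $\mathbb W_G$, and let $(p,\ell)\in\mathscr A$ be an $\mathscr A$-regular point of $G$. If $(G,p,\ell)$ has an $\mathscr A$-preserving infinitesimal flex, then it has an $\mathscr A$-preserving finite flex. -/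

import Mathlib

open scoped ContDiff Topology

noncomputable section

namespace PointHyperplane

/-- Configurations of points `p i` (`i ∈ P`) and hyperplanes `ℓ j = (a j, r j)` (`j ∈ H`) in `ℝ^d`:
`z.1 i` is the point `p i`, `(z.2 j).1` the normal `a j` and `(z.2 j).2` the offset `r j`. -/
abbrev Config (d : ℕ) (P H : Type*) :=
  (P → EuclideanSpace ℝ (Fin d)) × (H → EuclideanSpace ℝ (Fin d) × ℝ)

variable {d : ℕ} {P H : Type*}

/-- The hyperplane `{x | ⟨a, x⟩ - r = 0}` represented by the pair `(a, r)`. -/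
def hyperplane (m : EuclideanSpace ℝ (Fin d) × ℝ) : Set (EuclideanSpace ℝ (Fin d)) :=
  {x | inner ℝ m.1 x - m.2 = 0}

/-- The points and hyperplanes affinely span `ℝ^d`. -/
def Spans (z : Config d P H) : Prop :=
  affineSpan ℝ (Set.range z.1 ∪ ⋃ j, hyperplane (z.2 j)) = ⊤

/-- Two vectors are parallel if each is a multiple of the other. -/
def Parallel (a b : EuclideanSpace ℝ (Fin d)) : Prop :=
  ∃ c : ℝ, c ≠ 0 ∧ b = c • a

/-- A decorated point-hyperplane graph with point vertices `P` and hyperplane vertices `H`: a simple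
graph on the disjoint union, with a partition of `H` into parallel classes. -/
structure DecoratedGraph (P H : Type*) where
  graph : SimpleGraph (P ⊕ H)
  parallelClass : Setoid H

/-- The complete graph on the same vertices, with the decoration inherited from `G`. -/
def DecoratedGraph.complete (G : DecoratedGraph P H) : DecoratedGraph P H where
  graph := ⊤
  parallelClass := G.parallelClass

/-- `(G, p, ℓ)` is a decorated framework: the decoration of `G` is the one induced by `(p, ℓ)`. -/
def IsFramework (G : DecoratedGraph P H) (z : Config d P H) : Prop :=
  ∀ j k : H, G.parallelClass j k ↔ Parallel (z.2 j).1 (z.2 k).1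

/-- Point-point edges. -/
abbrev EdgePP (G : DecoratedGraph P H) :=
  {e : Sym2 P // e.map Sum.inl ∈ G.graph.edgeSet}

/-- Point-hyperplane edges. -/
abbrev EdgePH (G : DecoratedGraph P H) :=
  {e : P × H // G.graph.Adj (Sum.inl e.1) (Sum.inr e.2)}

/-- Hyperplane-hyperplane edges whose ends lie in different parallel classes. -/
abbrev EdgeHH (G : DecoratedGraph P H) :=
  {e : Sym2 H // e.map Sum.inr ∈ G.graph.edgeSet ∧
    ∀ j k : H, e = s(j, k) → ¬ G.parallelClass j k}

/-- The space `𝕎_G` of configurations for which the ends of every hyperplane-hyperplane edge inside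
a parallel class are parallel. -/
def parallelSpace (d : ℕ) (G : DecoratedGraph P H) : Set (Config d P H) :=
  {z | ∀ j k : H, G.graph.Adj (Sum.inr j) (Sum.inr k) → G.parallelClass j k →
    Parallel (z.2 j).1 (z.2 k).1}

/-- The formula for the measurement map `f_G`, written on all configurations. As a map it has
domain `𝕎_G`; see `fiber`. -/
def measurement (G : DecoratedGraph P H) (z : Config d P H) :
    (EdgePP G → ℝ) × (EdgePH G → ℝ) × (EdgeHH G → ℝ) × (H → ℝ) :=
  (fun e => Sym2.lift ⟨fun i j => ‖z.1 i - z.1 j‖ ^ 2,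
      fun i j => by simp only [norm_sub_rev]⟩ e.1,
   fun e => inner ℝ (z.1 e.1.1) (z.2 e.1.2).1 - (z.2 e.1.2).2,
   fun e => Sym2.lift ⟨fun j k => (inner ℝ (z.2 j).1 (z.2 k).1 : ℝ),
      fun _ _ => real_inner_comm _ _⟩ e.1,
   fun j => inner ℝ (z.2 j).1 (z.2 j).1)

/-- The fibre `f_G⁻¹(f_G(z))` of `f_G : 𝕎_G → ℝ^N`. -/
def fiber (G : DecoratedGraph P H) (z : Config d P H) : Set (Config d P H) :=
  {y | y ∈ parallelSpace d G ∧ measurement G y = measurement G z}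

/-- Trivial infinitesimal motions `u = (ṗ, (ȧ, ṙ))` of the configuration `z`. -/
def IsTrivialMotion (z u : Config d P H) : Prop :=
  ∃ (S : Matrix (Fin d) (Fin d) ℝ) (t : EuclideanSpace ℝ (Fin d)), S.transpose = -S ∧
    (∀ i, u.1 i = S.toEuclideanLin (z.1 i) + t) ∧
    ∀ j, u.2 j = (S.toEuclideanLin (z.2 j).1, inner ℝ t (z.2 j).1)

section Submanifold

variable {E : Type*} [NormedAddCommGroup E] [NormedSpace ℝ E]

/-- `A` is a smooth (embedded) submanifold of `E`: around each of its points some smooth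
diffeomorphism between open sets of `E` straightens `A` to a linear subspace, of a fixed
dimension. -/
def IsSmoothSubmanifold (A : Set E) : Prop :=
  ∃ m : ℕ, ∀ z ∈ A, ∃ (φ : OpenPartialHomeomorph E E) (L : Submodule ℝ E),
    z ∈ φ.source ∧ ContDiffOn ℝ ∞ φ φ.source ∧ ContDiffOn ℝ ∞ φ.symm φ.target ∧
    Module.finrank ℝ L = m ∧ φ '' (φ.source ∩ A) = φ.target ∩ (L : Set E)

/-- The tangent space of `A` at `z`: velocities at `z` of curves in `A`. For a submanifold these
velocities already form a linear subspace; the span makes it a `Submodule` for every set. -/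
def tangentSpaceAt (A : Set E) (z : E) : Submodule ℝ E :=
  Submodule.span ℝ {v | ∃ γ : ℝ → E, γ 0 = z ∧ (∀ᶠ s in 𝓝 0, γ s ∈ A) ∧ HasDerivAt γ v 0}

end Submanifold

variable [Fintype P] [Fintype H]

/-- The differential at `z` of the restriction `f̃_G` of `f_G` to `A`. -/
def restrictedDeriv (G : DecoratedGraph P H) (A : Set (Config d P H)) (z : Config d P H) :
    tangentSpaceAt A z →ₗ[ℝ]
      (EdgePP G → ℝ) × (EdgePH G → ℝ) × (EdgeHH G → ℝ) × (H → ℝ) :=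
  (fderiv ℝ (measurement G) z).toLinearMap.domRestrict (tangentSpaceAt A z)

/-- The rank of `d f̃_G(z)`. -/
def derivRank (G : DecoratedGraph P H) (A : Set (Config d P H)) (z : Config d P H) : ℕ :=
  Module.finrank ℝ (LinearMap.range (restrictedDeriv G A z))

/-- `z` is an `A`-regular point of `G`. -/
def IsRegularPoint (G : DecoratedGraph P H) (A : Set (Config d P H)) (z : Config d P H) : Prop :=
  z ∈ A ∧ ∃ N ∈ 𝓝[A] z, N ⊆ A ∧ IsGreatest (derivRank G A '' N) (derivRank G A z)

/-- `u` is an `A`-preserving infinitesimal flex of `(G, z)`. -/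
def IsInfinitesimalFlex (G : DecoratedGraph P H) (A : Set (Config d P H)) (z : Config d P H)
    (u : tangentSpaceAt A z) : Prop :=
  u ∈ LinearMap.ker (restrictedDeriv G A z) ∧ ¬ IsTrivialMotion z (u : Config d P H)

/-- `x : [0,1] → A` is an `A`-preserving (finite) flex of `(G, z)`. -/
def IsFiniteFlex (G : DecoratedGraph P H) (A : Set (Config d P H)) (z : Config d P H)
    (x : ℝ → Config d P H) : Prop :=
  DifferentiableOn ℝ x (Set.Icc 0 1) ∧ (∀ t ∈ Set.Icc (0 : ℝ) 1, x t ∈ A) ∧ x 0 = z ∧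
    ∀ t ∈ Set.Ioc (0 : ℝ) 1, x t ∈ fiber G z \ fiber G.complete z

end PointHyperplane

end

open PointHyperplane

namespace PointHyperplane

open Filter

/-! ### Linear algebra: generalized inverses and skew extensions. -/

section LinearAlgebra

/-! Local maximality of the rank makes the fibre of `f_G` restricted to `A` behave as in the
constant rank theorem: a kernel vector `u` is the velocity of a curve `γ` in that fibre
(`exists_curve_in_fiber`, carried to `A` through a straightening chart by
`exists_curve_in_submanifold_fiber`).

It remains to see that `γ` leaves the fibre of `f_K` at once. If it returned there at times
accumulating at `0`, the Gram matrix of the vectors `p i - p o` and of the normals `a j` would take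
its initial value at those times. Differentiating along them yields a skew map producing the
velocities (`exists_skew_of_frequently_gram_eq`), so `u` would be trivial. Hence `γ` avoids that
fibre on a punctured neighbourhood of `0`, and a rescaling of time gives the flex. -/

theorem exists_generalizedInverse {K V W : Type*} [Field K] [AddCommGroup V] [Module K V]
    [AddCommGroup W] [Module K W] (D : V →ₗ[K] W) :
    ∃ T : W →ₗ[K] V, ∀ v, D (T (D v)) = D v := by
  obtain ⟨g, hg⟩ := D.rangeRestrict.exists_rightInverse_of_surjective D.range_rangeRestrict
  obtain ⟨T, hT⟩ := g.exists_extend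
  refine ⟨T, fun v => ?_⟩
  have h1 : T (D v) = g (D.rangeRestrict v) := LinearMap.congr_fun hT (D.rangeRestrict v)
  have h2 := congrArg Subtype.val (LinearMap.congr_fun hg (D.rangeRestrict v))
  rw [h1]
  exact h2

theorem exists_comp_eq_of_ker_le {K U V W : Type*} [Field K] [AddCommGroup U] [Module K U]
    [AddCommGroup V] [Module K V] [AddCommGroup W] [Module K W] (X : U →ₗ[K] V) (C : U →ₗ[K] W)
    (h : LinearMap.ker X ≤ LinearMap.ker C) : ∃ B : V →ₗ[K] W, ∀ v, B (X v) = C v := by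
  obtain ⟨T, hT⟩ := exists_generalizedInverse X
  refine ⟨C ∘ₗ T, fun v => ?_⟩
  have : T (X v) - v ∈ LinearMap.ker C := h (by simp [hT v])
  simpa [sub_eq_zero] using this

/-- Composing with `N` can only enlarge the kernel, and by rank-nullity it does not if no rank is
lost. This is where maximality of the rank enters. -/
theorem ker_comp_eq_of_finrank_range_le {K U V W : Type*} [Field K] [AddCommGroup U] [Module K U]
    [AddCommGroup V] [Module K V] [AddCommGroup W] [Module K W] [FiniteDimensional K U]
    (M : U →ₗ[K] V) (N : V →ₗ[K] W)
    (h : Module.finrank K (LinearMap.range M) ≤ Module.finrank K (LinearMap.range (N ∘ₗ M))) :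
    LinearMap.ker M = LinearMap.ker (N ∘ₗ M) := by
  refine Submodule.eq_of_le_of_finrank_le (LinearMap.ker_le_ker_comp M N) ?_
  have h1 := M.finrank_range_add_finrank_ker
  have h2 := (N ∘ₗ M).finrank_range_add_finrank_ker
  omega

/-- A linear map that is skew on a subspace agrees there with a skew endomorphism. -/
theorem exists_skew_extension {E : Type*} [NormedAddCommGroup E] [InnerProductSpace ℝ E]
    [FiniteDimensional ℝ E] (X : Submodule ℝ E) (B : E →ₗ[ℝ] E)
    (hB : ∀ x ∈ X, ∀ y ∈ X, inner ℝ (B x) y + inner ℝ x (B y) = 0) :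
    ∃ S : E →ₗ[ℝ] E, (∀ u v, inner ℝ (S u) v = -inner ℝ u (S v)) ∧ ∀ x ∈ X, S x = B x := by
  let Q : E →ₗ[ℝ] E := X.starProjection.toLinearMap
  have hQ : ∀ u v, inner ℝ (Q u) v = inner ℝ u (Q v) :=
    fun u v => X.inner_starProjection_left_eq_right u v
  have hmem : ∀ u, Q u ∈ X := fun u => X.starProjection_apply_mem u
  have hfix : ∀ x ∈ X, Q x = x := fun x hx => Submodule.starProjection_eq_self_iff.2 hx
  let C : E →ₗ[ℝ] E := LinearMap.adjoint B
  -- With `Q` the orthogonal projection onto `X` and `C` the adjoint of `B`, the difference `BQ -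
  -- QC` is skew, and `QCQ` is skew because `B` is skew on `X`. On `X` the last two terms cancel.
  refine ⟨B ∘ₗ Q - Q ∘ₗ C + Q ∘ₗ C ∘ₗ Q, fun u v => ?_, fun x hx => ?_⟩
  · have h := hB _ (hmem u) _ (hmem v)
    simp only [LinearMap.add_apply, LinearMap.sub_apply, LinearMap.comp_apply, inner_add_left,
      inner_add_right, inner_sub_left, inner_sub_right, hQ, C, LinearMap.adjoint_inner_left]
    simp only [← hQ, LinearMap.adjoint_inner_right] at h ⊢
    linarith
  · simp [hfix x hx]

end LinearAlgebra

/-! ### Constant rank: curves in a fibre. -/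

section Curves

variable {X F : Type*} [NormedAddCommGroup X] [NormedSpace ℝ X] [FiniteDimensional ℝ X]
  [NormedAddCommGroup F] [NormedSpace ℝ F] [FiniteDimensional ℝ F]

/-- At a point where the rank of the derivative is locally maximal, every kernel vector is the
velocity of a curve in the fibre. -/
theorem exists_curve_in_fiber {f : X → F} {x₀ : X} (hf : ContDiffAt ℝ 1 f x₀)
    (hrank : ∀ᶠ x in 𝓝 x₀, Module.finrank ℝ (LinearMap.range (fderiv ℝ f x).toLinearMap) ≤
      Module.finrank ℝ (LinearMap.range (fderiv ℝ f x₀).toLinearMap))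
    {u : X} (hu : fderiv ℝ f x₀ u = 0) :
    ∃ γ : ℝ → X, γ 0 = x₀ ∧ HasDerivAt γ u 0 ∧
      ∀ᶠ t in 𝓝 0, DifferentiableAt ℝ γ t ∧ f (γ t) = f x₀ := by
  have : CompleteSpace X := FiniteDimensional.complete ℝ X
  set D := fderiv ℝ f x₀ with hD
  obtain ⟨T', hT'⟩ := exists_generalizedInverse D.toLinearMap
  let T : F →L[ℝ] X := LinearMap.toContinuousLinearMap T'
  have hT : ∀ v, D (T (D v)) = D v := hT'
  -- `Φ` has derivative the identity at `x₀`, and `D T D = D` gives `D ∘ Φ = D ∘ T ∘ f`. Its local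
  -- inverse `Ψ` therefore makes `D ∘ T ∘ f ∘ Ψ` equal to the linear map `D` near `Φ x₀`.
  let Φ : X → X := fun y => y + T (f y - D y)
  have hΦc : ContDiffAt ℝ 1 Φ x₀ := by
    refine contDiffAt_id.add (T.contDiff.contDiffAt.comp x₀ (hf.sub D.contDiff.contDiffAt))
  have hΦd : ∀ y, DifferentiableAt ℝ f y →
      HasFDerivAt Φ (ContinuousLinearMap.id ℝ X + T.comp (fderiv ℝ f y - D)) y := fun y hy =>
    (hasFDerivAt_id y).add (T.hasFDerivAt.comp y (hy.hasFDerivAt.sub D.hasFDerivAt))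
  have hΦ0 : HasFDerivAt Φ ((ContinuousLinearEquiv.refl ℝ X : X ≃L[ℝ] X) : X →L[ℝ] X) x₀ := by
    have := hΦd x₀ (hf.differentiableAt (by simp))
    convert this using 1
    ext v
    simp [← hD]
  have hst := hΦc.hasStrictFDerivAt' hΦ0 (by simp)
  let Ψ : X → X := hΦc.localInverse hΦ0 (by simp)
  have hΨ0 : Ψ (Φ x₀) = x₀ := hΦc.localInverse_apply_image hΦ0 (by simp)
  have hΨc : ContDiffAt ℝ 1 Ψ (Φ x₀) := hΦc.to_localInverse hΦ0 (by simp)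
  have hΨr : ∀ᶠ w in 𝓝 (Φ x₀), Φ (Ψ w) = w := hst.eventually_right_inverse
  have hΨd0 : HasFDerivAt Ψ (ContinuousLinearMap.id ℝ X) (Φ x₀) :=
    hst.to_localInverse.hasFDerivAt
  have hΨd : ∀ᶠ w in 𝓝 (Φ x₀), DifferentiableAt ℝ Ψ w :=
    (hΨc.eventually (by simp)).mono fun w hw => hw.differentiableAt (by simp)
  have hΨt : Tendsto Ψ (𝓝 (Φ x₀)) (𝓝 x₀) := by
    simpa [hΨ0] using hΨc.continuousAt.tendsto
  have hfd : ∀ᶠ y in 𝓝 x₀, DifferentiableAt ℝ f y :=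
    (hf.eventually (by simp)).mono fun w hw => hw.differentiableAt (by simp)
  have key : ∀ᶠ w in 𝓝 (Φ x₀), DifferentiableAt ℝ Ψ w ∧ DifferentiableAt ℝ f (Ψ w) ∧
      fderiv ℝ f (Ψ w) (fderiv ℝ Ψ w u) = 0 := by
    filter_upwards [hΨd, hΨr.eventually_nhds, hΨt.eventually hfd, hΨt.eventually hrank]
      with w h1 h2 h3 h4
    refine ⟨h1, h3, ?_⟩
    have hcomp := (hΦd _ h3).comp w h1.hasFDerivAt
    have hid : HasFDerivAt (Φ ∘ Ψ) (ContinuousLinearMap.id ℝ X) w :=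
      (hasFDerivAt_id w).congr_of_eventuallyEq h2
    have hv : ∀ v, D (T (fderiv ℝ f (Ψ w) (fderiv ℝ Ψ w v))) = D v := by
      intro v
      have h := congrArg D (DFunLike.congr_fun (hcomp.unique hid) v)
      simp only [ContinuousLinearMap.comp_apply, _root_.add_apply,
        ContinuousLinearMap.id_apply, _root_.sub_apply, map_add, map_sub, hT] at h
      simpa using h
    set M := (fderiv ℝ f (Ψ w)).toLinearMap with hM
    let N : F →ₗ[ℝ] F := D.toLinearMap ∘ₗ T.toLinearMap
    have hle : LinearMap.range D.toLinearMap ≤ LinearMap.range (N ∘ₗ M) := by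
      rintro _ ⟨v, rfl⟩
      exact ⟨fderiv ℝ Ψ w v, hv v⟩
    -- The ranks satisfy `rank M ≤ rank D ≤ rank (N ∘ M)`, so `D ∘ T` kills nothing in the range of
    -- `M`. As `D u = 0`, the derivative of `f ∘ Ψ` in direction `u` vanishes at every nearby point,
    -- and `f ∘ Ψ` is constant along the line in that direction.
    have hker := ker_comp_eq_of_finrank_range_le M N (h4.trans (Submodule.finrank_mono hle))
    have : fderiv ℝ Ψ w u ∈ LinearMap.ker (N ∘ₗ M) := (hv u).trans hu
    rw [← hker] at this
    exact this
  let line : ℝ → X := fun t => Φ x₀ + t • u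
  have hline : ∀ t, HasDerivAt line u t := fun t => by
    simpa only [one_smul] using! ((hasDerivAt_id t).smul_const u).const_add (Φ x₀)
  have hline0 : line 0 = Φ x₀ := by simp [line]
  have hlt : Tendsto line (𝓝 0) (𝓝 (Φ x₀)) := by
    simpa [hline0] using (hline 0).continuousAt.tendsto
  have hγ0 : (Ψ ∘ line) 0 = x₀ := by simp [hline0, hΨ0]
  refine ⟨Ψ ∘ line, hγ0, ?_, ?_⟩
  · rw [← hline0] at hΨd0
    simpa using hΨd0.comp_hasDerivAt 0 (hline 0)
  · obtain ⟨ε, hε, hball⟩ := Metric.eventually_nhds_iff_ball.1 (hlt.eventually key)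
    have hder : ∀ t ∈ Metric.ball (0 : ℝ) ε, HasDerivAt (f ∘ Ψ ∘ line) 0 t := fun t ht => by
      obtain ⟨h1, h2, h3⟩ := hball t ht
      have := h2.hasFDerivAt.comp_hasDerivAt t (h1.hasFDerivAt.comp_hasDerivAt t (hline t))
      rwa [h3] at this
    filter_upwards [Metric.ball_mem_nhds (0 : ℝ) hε] with t ht
    refine ⟨(hball t ht).1.comp t (hline t).differentiableAt, ?_⟩
    have := Metric.isOpen_ball.is_const_of_deriv_eq_zero
      (convex_ball (0 : ℝ) ε).isPreconnected
      (fun s hs => (hder s hs).differentiableAt.differentiableWithinAt)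
      (fun s hs => (hder s hs).deriv) ht (Metric.mem_ball_self hε)
    simpa [hline0, hΨ0] using this

end Curves

/-! ### Curves that return to their initial Gram matrix. -/

theorem deriv_eq_zero_of_frequently_eq {F : Type*} [NormedAddCommGroup F] [NormedSpace ℝ F]
    {g : ℝ → F} {g' : F} (hg : HasDerivAt g g' 0)
    (h : ∃ᶠ s in 𝓝[≠] 0, g s = g 0) : g' = 0 := by
  by_contra hne
  exact h (hg.eventually_ne hne)

/-- If curves in a Euclidean space recover their initial Gram matrix at times accumulating at `0`,
then their velocities are given by a skew map. -/
theorem exists_skew_of_frequently_gram_eq {ι E : Type*} [Fintype ι] [NormedAddCommGroup E]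
    [InnerProductSpace ℝ E] [FiniteDimensional ℝ E] {x : ι → ℝ → E} {x' : ι → E}
    (hx : ∀ α, HasDerivAt (x α) (x' α) 0)
    (hgram : ∃ᶠ s in 𝓝[≠] (0 : ℝ), ∀ α β, (inner ℝ (x α s) (x β s) : ℝ) =
      inner ℝ (x α 0) (x β 0)) :
    ∃ S : E →ₗ[ℝ] E, (∀ u v, inner ℝ (S u) v = -inner ℝ u (S v)) ∧ ∀ α, S (x α 0) = x' α := by
  have hskew : ∀ α β, (inner ℝ (x' α) (x β 0) : ℝ) + inner ℝ (x α 0) (x' β) = 0 := by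
    intro α β
    have := deriv_eq_zero_of_frequently_eq ((hx α).inner ℝ (hx β)) (hgram.mono fun s hs => hs α β)
    linarith
  -- The assignment `x α 0 ↦ x' α` is well defined: the Gram matrix determines the norm of a
  -- combination, so a linear relation at time `0` holds again at each return time, and
  -- differentiating it gives the same relation among the velocities.
  obtain ⟨B, hB⟩ := exists_comp_eq_of_ker_le (Fintype.linearCombination ℝ fun α => x α 0)
    (Fintype.linearCombination ℝ x') (by
      intro c hc
      rw [LinearMap.mem_ker, Fintype.linearCombination_apply] at hc ⊢
      have hd : HasDerivAt (fun s => ∑ α, c α • x α s) (∑ α, c α • x' α) 0 :=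
        HasDerivAt.fun_sum fun α _ => (hx α).const_smul (c α)
      refine deriv_eq_zero_of_frequently_eq hd (hgram.mono fun s hs => ?_)
      rw [hc, ← inner_self_eq_zero (𝕜 := ℝ)]
      have h0 : (inner ℝ (∑ α, c α • x α 0) (∑ α, c α • x α 0) : ℝ) = 0 := by rw [hc]; simp
      simpa only [sum_inner, inner_sum, real_inner_smul_left, real_inner_smul_right, hs] using h0)
  have hBx : ∀ α, B (x α 0) = x' α := fun α => by
    classical
    simpa [Fintype.linearCombination_apply_single] using hB (Pi.single α 1)
  obtain ⟨S, hS, hSB⟩ := exists_skew_extension (Submodule.span ℝ (Set.range fun α => x α 0)) B (by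
    intro v hv w hw
    induction hv using Submodule.span_induction with
    | mem v hv =>
      obtain ⟨α, rfl⟩ := hv
      induction hw using Submodule.span_induction with
      | mem w hw =>
        obtain ⟨β, rfl⟩ := hw
        simpa only [hBx] using hskew α β
      | zero => simp
      | add a b _ _ ha hb =>
        rw [map_add, inner_add_right, inner_add_right]; linarith
      | smul c a _ ha =>
        rw [map_smul, real_inner_smul_right, real_inner_smul_right, ← mul_add, ha, mul_zero]
    | zero => simp
    | add a b _ _ ha hb =>
      rw [map_add, inner_add_left, inner_add_left]; linarith
    | smul c a _ ha =>
      rw [map_smul, real_inner_smul_left, real_inner_smul_left, ← mul_add, ha, mul_zero])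
  exact ⟨S, hS, fun α => (hSB _ (Submodule.subset_span ⟨α, rfl⟩)).trans (hBx α)⟩

end PointHyperplane

namespace PointHyperplane

open Filter

/-! ### Tangent spaces and fibres on a submanifold. -/

section Submanifold

variable {E : Type*} [NormedAddCommGroup E] [NormedSpace ℝ E] {A : Set E}
  {φ : OpenPartialHomeomorph E E} {L : Submodule ℝ E}

theorem symm_mem_of_straightening (hφA : φ '' (φ.source ∩ A) = φ.target ∩ (L : Set E)) {w : L}
    (hw : (w : E) ∈ φ.target) : φ.symm w ∈ A := by
  have h : (w : E) ∈ φ '' (φ.source ∩ A) := hφA ▸ ⟨hw, w.2⟩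
  obtain ⟨a, ha, haw⟩ := h
  rw [← haw, φ.left_inv ha.1]
  exact ha.2

theorem contDiffAt_straightening_symm (hs : ContDiffOn ℝ ∞ φ.symm φ.target) {w : L}
    (hw : (w : E) ∈ φ.target) : ContDiffAt ℝ 1 (fun w : L => φ.symm w) w := by
  have h1 : ContDiffAt ℝ 1 φ.symm (L.subtypeL w) :=
    (hs.contDiffAt (φ.open_target.mem_nhds hw)).of_le (by exact_mod_cast le_top)
  exact h1.comp w L.subtypeL.contDiff.contDiffAt

variable [FiniteDimensional ℝ E]

/-- The tangent space of a submanifold is the image of the derivative of a local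
parametrisation. -/
theorem range_fderiv_straightening_symm (hφ : ContDiffOn ℝ ∞ φ φ.source)
    (hs : ContDiffOn ℝ ∞ φ.symm φ.target)
    (hφA : φ '' (φ.source ∩ A) = φ.target ∩ (L : Set E)) {w : L} (hw : (w : E) ∈ φ.target) :
    LinearMap.range (fderiv ℝ (fun w : L => φ.symm w) w).toLinearMap =
      tangentSpaceAt A (φ.symm w) := by
  have hψ : HasFDerivAt (fun w : L => φ.symm w) _ w :=
    ((contDiffAt_straightening_symm hs hw).differentiableAt (by simp)).hasFDerivAt
  apply le_antisymm
  · rintro _ ⟨v, rfl⟩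
    refine Submodule.subset_span ⟨fun s => φ.symm (w + s • v : L), by simp, ?_, ?_⟩
    · have hc : Tendsto (fun s : ℝ => ((w + s • v : L) : E)) (𝓝 0) (𝓝 w) := by
        have : Continuous fun s : ℝ => ((w + s • v : L) : E) := by fun_prop
        simpa using this.tendsto 0
      filter_upwards [hc.eventually (φ.open_target.mem_nhds hw)] with s hs
      exact symm_mem_of_straightening hφA hs
    · have hl : HasDerivAt (fun s : ℝ => w + s • v) v 0 := by
        simpa only [one_smul] using! ((hasDerivAt_id (0 : ℝ)).smul_const v).const_add w
      have hw0 : w + (0 : ℝ) • v = w := by simp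
      rw [← hw0] at hψ
      simpa using! hψ.comp_hasDerivAt 0 hl
  · refine Submodule.span_le.2 ?_
    rintro v ⟨γ, hγ0, hγA, hγ⟩
    -- A linear retraction `q` onto `L` turns a curve in `A` into a differentiable curve in `L`,
    -- since `φ ∘ γ` already takes values in `L` near time `0`.
    obtain ⟨q', hq'⟩ := L.subtype.exists_leftInverse_of_injective L.ker_subtype
    let q : E →L[ℝ] L := LinearMap.toContinuousLinearMap q'
    have hq : ∀ x : L, q x = x := fun x => LinearMap.congr_fun hq' x
    have hsrc : γ 0 ∈ φ.source := hγ0 ▸ φ.map_target hw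
    have hφd : HasFDerivAt φ (fderiv ℝ φ (γ 0)) (γ 0) :=
      ((hφ.contDiffAt (φ.open_source.mem_nhds hsrc)).differentiableAt (by simp)).hasFDerivAt
    have hδ := q.hasFDerivAt.comp_hasDerivAt 0 (hφd.comp_hasDerivAt 0 hγ)
    have hδ0 : q (φ (γ 0)) = w := by rw [hγ0, φ.right_inv hw, hq]
    have hψ' := hψ
    rw [← hδ0] at hψ'
    have hcomp := hψ'.comp_hasDerivAt 0 hδ
    have heq : ∀ᶠ s in 𝓝 0, γ s = φ.symm (q (φ (γ s)) : L) := by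
      filter_upwards [hγA, hγ.continuousAt.tendsto.eventually (φ.open_source.mem_nhds hsrc)]
        with s h1 h2
      have hL : φ (γ s) ∈ φ.target ∩ (L : Set E) := hφA ▸ ⟨γ s, ⟨h2, h1⟩, rfl⟩
      have hfix : (q (φ (γ s)) : E) = φ (γ s) := congrArg Subtype.val (hq ⟨_, hL.2⟩)
      rw [hfix, φ.left_inv h2]
    have := hγ.unique (hcomp.congr_of_eventuallyEq heq)
    rw [this, hδ0]
    exact ⟨_, rfl⟩

/-- The constant rank principle on a submanifold: at a point where the rank of the restricted
differential is locally maximal, every tangent vector in its kernel is the velocity of a curve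
in the fibre of the restricted map. -/
theorem exists_curve_in_submanifold_fiber {F : Type*} [NormedAddCommGroup F] [NormedSpace ℝ F]
    [FiniteDimensional ℝ F] (hA : IsSmoothSubmanifold A) {z : E} (hz : z ∈ A) {f : E → F}
    (hf : ContDiff ℝ 1 f)
    (hrank : ∀ᶠ y in 𝓝[A] z,
      Module.finrank ℝ ((tangentSpaceAt A y).map (fderiv ℝ f y).toLinearMap) ≤
        Module.finrank ℝ ((tangentSpaceAt A z).map (fderiv ℝ f z).toLinearMap))
    {u : E} (hu : u ∈ tangentSpaceAt A z) (hu0 : fderiv ℝ f z u = 0) :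
    ∃ γ : ℝ → E, γ 0 = z ∧ HasDerivAt γ u 0 ∧
      ∀ᶠ t in 𝓝 0, DifferentiableAt ℝ γ t ∧ γ t ∈ A ∧ f (γ t) = f z := by
  obtain ⟨m, hm⟩ := hA
  obtain ⟨φ, L, hzs, hφ, hs, -, hφA⟩ := hm z hz
  have hzL : φ z ∈ φ.target ∩ (L : Set E) := hφA ▸ ⟨z, ⟨hzs, hz⟩, rfl⟩
  let x₀ : L := ⟨φ z, hzL.2⟩
  let ψ : L → E := fun w => φ.symm w
  have hψ0 : ψ x₀ = z := φ.left_inv hzs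
  have hx₀ : (x₀ : E) ∈ φ.target := hzL.1
  have hψc : ContDiffAt ℝ 1 ψ x₀ := contDiffAt_straightening_symm hs hx₀
  have htarget : ∀ᶠ w : L in 𝓝 x₀, (w : E) ∈ φ.target :=
    continuous_subtype_val.continuousAt.eventually (φ.open_target.mem_nhds hx₀)
  have hψA : ∀ᶠ w in 𝓝 x₀, ψ w ∈ A := htarget.mono fun w hw => symm_mem_of_straightening hφA hw
  have hψt : Tendsto ψ (𝓝 x₀) (𝓝[A] z) := tendsto_nhdsWithin_iff.2
    ⟨by simpa [hψ0] using hψc.continuousAt.tendsto, hψA⟩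
  have hψd : ∀ w : L, (w : E) ∈ φ.target → DifferentiableAt ℝ ψ w := fun w hw =>
    (contDiffAt_straightening_symm hs hw).differentiableAt (by simp)
  have hcomp : ∀ w : L, (w : E) ∈ φ.target →
      fderiv ℝ (f ∘ ψ) w = (fderiv ℝ f (ψ w)).comp (fderiv ℝ ψ w) := fun w hw =>
    fderiv_comp w (hf.differentiable (by simp) _) (hψd w hw)
  have hrange : ∀ w : L, (w : E) ∈ φ.target →
      LinearMap.range (fderiv ℝ (f ∘ ψ) w).toLinearMap =
        (tangentSpaceAt A (ψ w)).map (fderiv ℝ f (ψ w)).toLinearMap := fun w hw => by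
    rw [← range_fderiv_straightening_symm hφ hs hφA hw, hcomp w hw, ← LinearMap.range_comp]
    rfl
  rw [← hψ0, ← range_fderiv_straightening_symm hφ hs hφA hx₀] at hu
  obtain ⟨u', hu'⟩ := hu
  have hu' : fderiv ℝ ψ x₀ u' = u := hu'
  obtain ⟨γ, hγ0, hγ, hev⟩ := exists_curve_in_fiber (f := f ∘ ψ) (x₀ := x₀) (u := u')
    (hf.contDiffAt.comp x₀ hψc) (by
      filter_upwards [htarget, hψt.eventually hrank] with w h1 h2
      rw [hrange w h1, hrange x₀ hx₀, hψ0]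
      exact h2) (by rw [hcomp x₀ hx₀, ContinuousLinearMap.comp_apply, hu', hψ0, hu0])
  have hγt : Tendsto γ (𝓝 0) (𝓝 x₀) := by simpa [hγ0] using hγ.continuousAt.tendsto
  refine ⟨ψ ∘ γ, by simp [hγ0, hψ0], ?_, ?_⟩
  · have h := (hψd x₀ hx₀).hasFDerivAt
    rw [← hu']
    rw [← hγ0] at h ⊢
    exact h.comp_hasDerivAt 0 hγ
  · filter_upwards [hev, hγt.eventually hψA, hγt.eventually htarget] with t h1 h2 h3
    exact ⟨(hψd _ h3).comp t h1.1, h2, by simpa [hψ0] using h1.2⟩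

end Submanifold

/-! ### Congruence of frameworks and trivial motions. -/

section Frameworks

variable {d : ℕ} {P H : Type*}

/-- The equality case of Cauchy-Schwarz. -/
theorem Parallel.inner_sq {a b : EuclideanSpace ℝ (Fin d)} (h : Parallel a b) :
    (inner ℝ a b : ℝ) ^ 2 = inner ℝ a a * inner ℝ b b := by
  obtain ⟨c, -, rfl⟩ := h
  simp only [real_inner_smul_left, real_inner_smul_right]
  ring

section Complete

variable {G : DecoratedGraph P H} {z y : Config d P H}

theorem norm_sub_eq_of_mem_fiber_complete (h : y ∈ fiber G.complete z) (i k : P) :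
    ‖y.1 i - y.1 k‖ ^ 2 = ‖z.1 i - z.1 k‖ ^ 2 := by
  rcases eq_or_ne i k with rfl | hik
  · simp
  · have hm := congrArg Prod.fst h.2
    exact congrFun hm ⟨s(i, k), by simpa [DecoratedGraph.complete] using hik⟩

theorem inner_sub_eq_of_mem_fiber_complete (h : y ∈ fiber G.complete z) (i : P) (j : H) :
    (inner ℝ (y.1 i) (y.2 j).1 : ℝ) - (y.2 j).2 = inner ℝ (z.1 i) (z.2 j).1 - (z.2 j).2 := by
  have hm := congrArg (fun m => m.2.1) h.2
  exact congrFun hm ⟨(i, j), by simp [DecoratedGraph.complete]⟩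

theorem inner_self_eq_of_mem_fiber_complete (h : y ∈ fiber G.complete z) (j : H) :
    (inner ℝ (y.2 j).1 (y.2 j).1 : ℝ) = inner ℝ (z.2 j).1 (z.2 j).1 := by
  have hm := congrArg (fun m => m.2.2.2) h.2
  exact congrFun hm j

/-- Within a parallel class `f_K` does not measure `⟨a j, a k⟩`; parallelism and the two norms fix
only its square. -/
theorem inner_normal_eq_or_eq_neg_of_mem_fiber_complete (hz : IsFramework G z)
    (h : y ∈ fiber G.complete z) (j k : H) :
    (inner ℝ (y.2 j).1 (y.2 k).1 : ℝ) = inner ℝ (z.2 j).1 (z.2 k).1 ∨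
      (inner ℝ (y.2 j).1 (y.2 k).1 : ℝ) = -inner ℝ (z.2 j).1 (z.2 k).1 := by
  rcases eq_or_ne j k with rfl | hjk
  · exact Or.inl (inner_self_eq_of_mem_fiber_complete h j)
  by_cases hc : G.parallelClass j k
  · have hy : Parallel (y.2 j).1 (y.2 k).1 := h.1 j k (by simpa [DecoratedGraph.complete]) hc
    refine sq_eq_sq_iff_eq_or_eq_neg.1 ?_
    rw [hy.inner_sq, ((hz j k).1 hc).inner_sq, inner_self_eq_of_mem_fiber_complete h,
      inner_self_eq_of_mem_fiber_complete h]
  · have hm := congrArg (fun m => m.2.2.1) h.2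
    refine Or.inl (congrFun hm ⟨s(j, k), by simpa [DecoratedGraph.complete] using hjk, ?_⟩)
    intro j' k' he hc'
    rcases Sym2.eq_iff.1 he with ⟨rfl, rfl⟩ | ⟨rfl, rfl⟩
    · exact hc hc'
    · exact hc (G.parallelClass.symm hc')

end Complete

theorem inner_sub_sub_eq (p q r : EuclideanSpace ℝ (Fin d)) :
    (inner ℝ (p - r) (q - r) : ℝ) = (‖p - r‖ ^ 2 + ‖q - r‖ ^ 2 - ‖p - q‖ ^ 2) / 2 := by
  have h := norm_sub_sq_real (p - r) (q - r)
  rw [sub_sub_sub_cancel_right] at h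
  linarith

theorem exists_matrix_of_skew {S : EuclideanSpace ℝ (Fin d) →ₗ[ℝ] EuclideanSpace ℝ (Fin d)}
    (hS : ∀ u v, inner ℝ (S u) v = -inner ℝ u (S v)) :
    ∃ M : Matrix (Fin d) (Fin d) ℝ, M.transpose = -M ∧ M.toEuclideanLin = S := by
  refine ⟨Matrix.toEuclideanLin.symm S, ?_, by simp⟩
  apply Matrix.toEuclideanLin.injective
  have hadj : LinearMap.adjoint S = -S := by
    symm
    rw [LinearMap.eq_adjoint_iff]
    intro u v
    simp [hS]
  rw [← Matrix.conjTranspose_eq_transpose_of_trivial,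
    Matrix.toEuclideanLin_conjTranspose_eq_adjoint, map_neg]
  simpa using hadj

variable [Fintype P] [Fintype H]

/-- The velocity of a curve which returns, at times accumulating at `0`, to the congruence class
of its starting point is a trivial motion. -/
theorem isTrivialMotion_of_frequently_mem_fiber_complete [Nonempty P] {G : DecoratedGraph P H}
    {z u : Config d P H} (hz : IsFramework G z) {γ : ℝ → Config d P H} (hγ0 : γ 0 = z)
    (hγ : HasDerivAt γ u 0) (h : ∃ᶠ s in 𝓝[≠] 0, γ s ∈ fiber G.complete z) :
    IsTrivialMotion z u := by
  obtain ⟨o⟩ := ‹Nonempty P›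
  have hp : ∀ i, HasDerivAt (fun s => (γ s).1 i) (u.1 i) 0 := fun i =>
    hasDerivAt_pi.1 hγ.fst i
  have hl : ∀ j, HasDerivAt (fun s => (γ s).2 j) (u.2 j) 0 := fun j =>
    hasDerivAt_pi.1 hγ.snd j
  have ha : ∀ j, HasDerivAt (fun s => ((γ s).2 j).1) (u.2 j).1 0 := fun j =>
    (hl j).fst
  have hr : ∀ j, HasDerivAt (fun s => ((γ s).2 j).2) (u.2 j).2 0 := fun j =>
    (hl j).snd
  -- Near time `0`, continuity excludes the opposite sign, except when the product is `0` and both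
  -- signs agree.
  have hsign : ∀ᶠ s in 𝓝[≠] (0 : ℝ), ∀ j k,
      (inner ℝ ((γ s).2 j).1 ((γ s).2 k).1 : ℝ) = -inner ℝ (z.2 j).1 (z.2 k).1 →
      (inner ℝ ((γ s).2 j).1 ((γ s).2 k).1 : ℝ) = inner ℝ (z.2 j).1 (z.2 k).1 := by
    refine eventually_all.2 fun j => eventually_all.2 fun k => ?_
    by_cases hw : (inner ℝ (z.2 j).1 (z.2 k).1 : ℝ) = 0
    · simp [hw]
    · have hc := ((ha j).inner ℝ (ha k)).continuousAt.tendsto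
      have hne : (inner ℝ ((γ 0).2 j).1 ((γ 0).2 k).1 : ℝ) ≠ -inner ℝ (z.2 j).1 (z.2 k).1 := by
        rw [hγ0]
        intro he
        exact hw (by linarith)
      exact ((hc.eventually_ne hne).filter_mono nhdsWithin_le_nhds).mono
        fun s hs he => absurd he hs
  -- Subtracting the base point `o` removes translations, and in the pairings with normals it
  -- cancels the offsets.
  let x : P ⊕ H → ℝ → EuclideanSpace ℝ (Fin d) :=
    Sum.elim (fun i s => (γ s).1 i - (γ s).1 o) (fun j s => ((γ s).2 j).1)
  let x' : P ⊕ H → EuclideanSpace ℝ (Fin d) := Sum.elim (fun i => u.1 i - u.1 o) fun j => (u.2 j).1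
  have hx : ∀ α, HasDerivAt (x α) (x' α) 0 := by
    rintro (i | j)
    · exact (hp i).sub (hp o)
    · exact ha j
  obtain ⟨S, hS, hSx⟩ := exists_skew_of_frequently_gram_eq hx (by
    refine (h.and_eventually hsign).mono ?_
    rintro s ⟨hs, hs'⟩
    have hPH : ∀ i j, (inner ℝ ((γ s).1 i - (γ s).1 o) ((γ s).2 j).1 : ℝ) =
        inner ℝ (z.1 i - z.1 o) (z.2 j).1 := fun i j => by
      have h1 := inner_sub_eq_of_mem_fiber_complete hs i j
      have h2 := inner_sub_eq_of_mem_fiber_complete hs o j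
      rw [inner_sub_left, inner_sub_left]
      linarith
    rintro (i | j) (k | l) <;> simp only [x, Sum.elim_inl, Sum.elim_inr, hγ0]
    · simp only [inner_sub_sub_eq, norm_sub_eq_of_mem_fiber_complete hs]
    · exact hPH i l
    · rw [real_inner_comm, hPH, real_inner_comm]
    · exact (inner_normal_eq_or_eq_neg_of_mem_fiber_complete hz hs j l).elim id (hs' j l))
  have hSp : ∀ i, S (z.1 i) - S (z.1 o) = u.1 i - u.1 o := fun i => by
    simpa [x, x', hγ0] using hSx (Sum.inl i)
  have hSa : ∀ j, S (z.2 j).1 = (u.2 j).1 := fun j => by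
    simpa [x, x', hγ0] using hSx (Sum.inr j)
  obtain ⟨M, hM, hMS⟩ := exists_matrix_of_skew hS
  -- The translation part is dictated by the motion of the base point.
  refine ⟨M, u.1 o - S (z.1 o), hM, fun i => ?_, fun j => ?_⟩
  · rw [hMS, sub_eq_iff_eq_add.1 (hSp i).symm]
    abel
  · rw [hMS, hSa]
    refine Prod.ext rfl ?_
    -- Differentiating `⟨p o, a j⟩ - r j` along the return times determines the velocity of the
    -- offset; skewness of `S` then gives the required form.
    have hd := deriv_eq_zero_of_frequently_eq (((hp o).inner ℝ (ha j)).sub (hr j))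
      (h.mono fun s hs => by
        simpa [hγ0] using inner_sub_eq_of_mem_fiber_complete hs o j)
    rw [hγ0, ← hSa] at hd
    simp only [inner_sub_left, hS]
    linarith

theorem contDiff_measurement (G : DecoratedGraph P H) [Fintype (EdgePP G)] [Fintype (EdgePH G)]
    [Fintype (EdgeHH G)] :
    ContDiff ℝ 1 (measurement (d := d) G) := by
  have hp : ∀ i, ContDiff ℝ 1 fun y : Config d P H => y.1 i := fun i => by fun_prop
  have hl : ∀ j, ContDiff ℝ 1 fun y : Config d P H => y.2 j := fun j => by fun_prop
  refine (contDiff_pi.2 ?_).prodMk ((contDiff_pi.2 ?_).prodMk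
    ((contDiff_pi.2 ?_).prodMk (contDiff_pi.2 ?_)))
  · rintro ⟨e, he⟩
    induction e with | _ i k
    exact ((hp i).sub (hp k)).norm_sq ℝ
  · rintro ⟨⟨i, j⟩, he⟩
    exact ((hp i).inner ℝ (hl j).fst).sub (hl j).snd
  · rintro ⟨e, he⟩
    induction e with | _ j k
    exact (hl j).fst.inner ℝ (hl k).fst
  · intro j
    exact (hl j).fst.inner ℝ (hl j).fst

end Frameworks

end PointHyperplane

/-! ### The finite flex. -/

theorem mainTheorem6 {d : ℕ} {P H : Type*} [Fintype P] [Fintype H] [Nonempty P]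
    (G : DecoratedGraph P H) (z : Config d P H) (hz : IsFramework G z) (hspan : Spans z)
    (A : Set (Config d P H)) (hA : IsSmoothSubmanifold A) (hAW : A ⊆ parallelSpace d G)
    (hreg : IsRegularPoint G A z) (hflex : ∃ u, IsInfinitesimalFlex G A z u) :
    ∃ x, IsFiniteFlex G A z x := by
  obtain ⟨hzA, N, hN, -, -, hmax⟩ := hreg
  obtain ⟨⟨u, huT⟩, hu0, hunt⟩ := hflex
  have : Fintype (EdgePP G) := Fintype.ofFinite _
  have : Fintype (EdgePH G) := Fintype.ofFinite _
  have : Fintype (EdgeHH G) := Fintype.ofFinite _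
  obtain ⟨γ, hγ0, hγ, hev⟩ := exists_curve_in_submanifold_fiber hA hzA (contDiff_measurement G)
    (by
      filter_upwards [hN] with y hy
      have h := hmax ⟨y, hy, rfl⟩
      rw [derivRank, derivRank, restrictedDeriv, restrictedDeriv, LinearMap.range_domRestrict,
        LinearMap.range_domRestrict] at h
      exact h) huT hu0
  have hout : ∀ᶠ s in 𝓝[≠] 0, γ s ∉ fiber G.complete z :=
    Filter.not_frequently.1 fun h =>
      hunt (isTrivialMotion_of_frequently_mem_fiber_complete hz hγ0 hγ h)
  obtain ⟨ε, hε, hball⟩ :=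
    Metric.eventually_nhds_iff_ball.1 (hev.and (eventually_nhdsWithin_iff.1 hout))
  have hmem : ∀ t ∈ Set.Icc (0 : ℝ) 1, ε / 2 * t ∈ Metric.ball (0 : ℝ) ε := fun t ht => by
    rw [mem_ball_zero_iff, Real.norm_eq_abs, abs_of_nonneg (mul_nonneg (by positivity) ht.1)]
    nlinarith [ht.2]
  -- The factor `ε / 2` keeps the endpoint `t = 1` inside the open ball of radius `ε`.
  refine ⟨fun t => γ (ε / 2 * t), fun t ht => ?_, fun t ht => (hball _ (hmem t ht)).1.2.1,
    by simp [hγ0], fun t ht => ?_⟩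
  · exact ((hball _ (hmem t ht)).1.1.comp t
      ((differentiableAt_id).const_mul (ε / 2))).differentiableWithinAt
  · obtain ⟨⟨-, h1, h2⟩, h3⟩ := hball _ (hmem t ⟨ht.1.le, ht.2⟩)
    have := ht.1
    exact ⟨⟨hAW h1, h2⟩, h3 (by simp only [Set.mem_compl_iff, Set.mem_singleton_iff]; positivity)⟩
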